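/- Let $2<p<\infty$ and $\frac1p+\frac1q=1$. Put $\varphi(R)=R|R|^{p-2}$, and $\lambda(R)=\frac{1}{1+R}-\frac{p-1}{1+\varphi(R)}$ for $R\neq-1$, $\lambda(-1)=-\frac{p-2}{2}$. Let $R_0\in(0,1)$ be the (unique) solution in $(0,1)$ of $$R_0^{\frac{p-1}{2}}+R_0^{-\frac{p-1}{2}}=(p-1)\big(R_0^{\frac12}+R_0^{-\frac12}\big),$$ and, for $R\in[-1,R_0]$, let $\rho(R)$ be the (unique) number in $[R_0,1]$ with $\lambda(\rho(R))=\lambda(R)$. Let $I\subset\mathbb R$ be a compact interval of positive length and write $\langle h\rangle_I=|I|^{-1}\int_I h$. For $x=(x_1,x_3,x_4,x_5)\in\mathbb R^4$ let $\mathbb B_{d,+}(x)$ and $\mathbb B_{d,-}(x)$ be, respectively, the supremum and the infimum of $\langle g\rangle_I$ over all real-valued $f\in L^p(I)$, $g\in L^q(I)$ with $\langle f\rangle_I=x_1$, $\langle|f|^p\rangle_I=x_3$, $\langle|g|^q\rangle_I=x_4$, $\langle fg\rangle_I=x_5$ (with $\sup\emptyset=-\infty$, $\inf\emptyset=+\infty$).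 For $R\in[-1,R_0]$ and $a_1,a_2\in\mathbb R$ let $\ell_d(a_1,a_2,R)\subset\mathbb R^4$ be the segment with the endpoints $$a=(a_1,|a_1|^p,|a_2|^q,a_1a_2),\qquad b=(-\rho(R)a_1,\ |\rho(R)a_1|^p,\ |R|^p|a_2|^q,\ \rho(R)\varphi(R)a_1a_2).$$ Theorem. Let $R\in[-1,R_0]$ and $a_1,a_2\in\mathbb R$ with $a_1\neq0$. If $a_2>0$, then $\mathbb B_{d,+}$ is linear on $\ell_d(a_1,a_2,R)$, i.e. it is finite on this segment and coincides there with an affine function. If $a_2<0$, then $\mathbb B_{d,-}$ is linear on $\ell_d(a_1,a_2,R)$. -/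

import Mathlib

open MeasureTheory Set

/-- The function `φ(R) = R |R|^(p-2)`. -/
noncomputable def phi (p R : ℝ) : ℝ := R * |R| ^ (p - 2)

/-- The function `λ`, with its continuous value `-(p-2)/2` at `R = -1`. -/
noncomputable def lam (p R : ℝ) : ℝ :=
  if R = -1 then -((p - 2) / 2) else 1 / (1 + R) - (p - 1) / (1 + phi p R)

/-- `R` lies in `(0,1)` and solves
`R^((p-1)/2) + R^(-(p-1)/2) = (p-1) (R^(1/2) + R^(-1/2))`. -/
def IsCriticalRadius (p R : ℝ) : Prop :=
  R ∈ Ioo (0 : ℝ) 1 ∧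
    R ^ ((p - 1) / 2) + R ^ (-((p - 1) / 2)) =
      (p - 1) * (R ^ ((1 : ℝ) / 2) + R ^ (-((1 : ℝ) / 2)))

/-- The number `R₀`: the solution singled out by `IsCriticalRadius` (it exists and is unique
when `p > 2`). -/
noncomputable def R0 (p : ℝ) : ℝ := Classical.epsilon (IsCriticalRadius p)

/-- The function `ρ : [-1,1] → [R₀,1]`: for `R ≤ R₀` it is the solution `s ∈ [R₀,1]` of
`λ(s) = λ(R)` (which exists and is unique when `p > 2`), and `ρ(R) = R` for `R ≥ R₀`. -/
noncomputable def rho (p R : ℝ) : ℝ :=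
  if R ≤ R0 p then Classical.epsilon (fun s => s ∈ Icc (R0 p) 1 ∧ lam p s = lam p R) else R

/-- The pairs `(f, g)` of real functions on `I = [α, β]` with `f ∈ L^p`, `g ∈ L^q` and
`⟨f⟩ = x₁`, `⟨|f|^p⟩ = x₃`, `⟨|g|^q⟩ = x₄`, `⟨f g⟩ = x₅`, where
`x = ![x₁, x₃, x₄, x₅]` and `⟨·⟩` is the average over `I`. -/
structure IsAdmissible (α β p q : ℝ) (x : Fin 4 → ℝ) (f g : ℝ → ℝ) : Prop where
  memLp_f : MemLp f (ENNReal.ofReal p) (volume.restrict (Icc α β))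
  memLp_g : MemLp g (ENNReal.ofReal q) (volume.restrict (Icc α β))
  average_f : (⨍ s in Icc α β, f s) = x 0
  average_f_pow : (⨍ s in Icc α β, |f s| ^ p) = x 1
  average_g_pow : (⨍ s in Icc α β, |g s| ^ q) = x 2
  average_mul : (⨍ s in Icc α β, f s * g s) = x 3

/-- The Bellman function `B_{d,+}` (equal to `-∞` where there is no admissible pair). -/
noncomputable def bellmanDPlus (α β p q : ℝ) (x : Fin 4 → ℝ) : EReal :=
  sSup {y : EReal | ∃ f g : ℝ → ℝ, IsAdmissible α β p q x f g ∧
    y = ((⨍ s in Icc α β, g s : ℝ) : EReal)}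

/-- The companion Bellman function `B_{d,-}` (equal to `+∞` where there is no admissible pair). -/
noncomputable def bellmanDMinus (α β p q : ℝ) (x : Fin 4 → ℝ) : EReal :=
  sInf {y : EReal | ∃ f g : ℝ → ℝ, IsAdmissible α β p q x f g ∧
    y = ((⨍ s in Icc α β, g s : ℝ) : EReal)}

/-- The endpoint `a = (a₁, |a₁|^p, |a₂|^q, a₁ a₂)`. -/
noncomputable def endpointA (p q a₁ a₂ : ℝ) : Fin 4 → ℝ :=
  ![a₁, |a₁| ^ p, |a₂| ^ q, a₁ * a₂]

/-- The endpoint `b = (-ρ(R) a₁, |ρ(R) a₁|^p, |R|^p |a₂|^q, ρ(R) φ(R) a₁ a₂)`. -/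
noncomputable def endpointB (p q a₁ a₂ R : ℝ) : Fin 4 → ℝ :=
  ![-rho p R * a₁, |rho p R * a₁| ^ p, |R| ^ p * |a₂| ^ q, rho p R * phi p R * a₁ * a₂]

/-- The segment `ℓ_d(a₁, a₂, R)`. -/
noncomputable def segmentD (p q a₁ a₂ R : ℝ) : Set (Fin 4 → ℝ) :=
  segment ℝ (endpointA p q a₁ a₂) (endpointB p q a₁ a₂ R)

/-- An extended-real function is linear on a set if it is finite there and coincides there with
a (real-valued) affine function. -/
def IsLinearOn (B : (Fin 4 → ℝ) → EReal) (S : Set (Fin 4 → ℝ)) : Prop :=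
  ∃ L : (Fin 4 → ℝ) →ᵃ[ℝ] ℝ, ∀ x ∈ S, B x = ((L x : ℝ) : EReal)

/-! The endpoints of the segment are the Bellman points of constant pairs `(u₁, v₁) = (a₁, a₂)` and
`(u₂, v₂) = (-ρ(R) a₁, -φ(R) a₂)`. A step function taking these two pairs of values realises every
point of the segment, and its average of `g` is affine along it. For the matching upper bound it
suffices to find a form `c₀ + c₁u + c₂|u|^p + c₃|v|^q + c₄uv` that dominates `v` on the plane and
equals it at the two pairs: averaging turns it into an affine bound
(`HasMultipliers.exists_isGreatest`).

By scaling, `a₁ = a₂ = 1`. Write `r = ρ(R)`. Young's inequality eliminates `v` and leaves a function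
of `u` that must be nonnegative with double zeros at `1` and `-r`. The tangency conditions and the
zero at `1` fix its coefficients, and the zero at `-r` is then exactly `λ(r) = λ(R)`. It is convex,
then concave, then convex, which forces nonnegativity (`hasMultipliers_of_lam_eq`).

At `R = R₀ = r` this form degenerates. There both pairs lie on the curve `v = φ(u)`, where Young's
inequality is an equality; hence `g = φ(f)` almost everywhere, and a one-variable bound for `φ`
suffices (`hasMultipliers_of_isCriticalRadius`). The case `R = -1` is Young's inequality in `v`
alone. The statement for the infimum follows by `g ↦ -g`. -/

/-! ### The odd power `φ` and its calculus -/

theorem phi_one (p : ℝ) : phi p 1 = 1 := by simp [phi]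

theorem phi_neg (p R : ℝ) : phi p (-R) = -phi p R := by simp [phi]

theorem abs_phi {p : ℝ} (hp : 2 < p) (R : ℝ) : |phi p R| = |R| ^ (p - 1) := by
  rcases eq_or_ne R 0 with rfl | hR
  · simp [phi, Real.zero_rpow (show p - 1 ≠ 0 by linarith)]
  · rw [phi, abs_mul, abs_of_nonneg (Real.rpow_nonneg (abs_nonneg R) _),
      show p - 1 = 1 + (p - 2) by ring, Real.rpow_add (abs_pos.2 hR), Real.rpow_one]

theorem phi_of_nonneg {p R : ℝ} (hp : 2 < p) (hR : 0 ≤ R) : phi p R = R ^ (p - 1) := by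
  have h := abs_phi hp R
  rwa [abs_of_nonneg hR, abs_of_nonneg] at h
  exact mul_nonneg hR (Real.rpow_nonneg (abs_nonneg R) _)

theorem mul_phi {p : ℝ} (hp : 2 < p) (R : ℝ) : R * phi p R = |R| ^ p := by
  rcases eq_or_ne R 0 with rfl | hR
  · simp [Real.zero_rpow (show p ≠ 0 by linarith)]
  · have h : |R| ^ p = |R| * |R| * |R| ^ (p - 2) := by
      rw [show |R| ^ p = |R| ^ (1 + 1 + (p - 2)) by congr 1; ring,
        Real.rpow_add (abs_pos.2 hR), Real.rpow_add (abs_pos.2 hR), Real.rpow_one]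
    rw [h, phi, ← mul_assoc, abs_mul_abs_self]

theorem abs_phi_rpow {p q : ℝ} (hp : 2 < p) (hpq : p.HolderConjugate q) (R : ℝ) :
    |phi p R| ^ q = |R| ^ p := by
  rw [abs_phi hp, ← Real.rpow_mul (abs_nonneg R), hpq.sub_one_mul_conj]

theorem hasDerivAt_phi {p : ℝ} (hp : 2 < p) (x : ℝ) :
    HasDerivAt (phi p) ((p - 1) * |x| ^ (p - 2)) x := by
  rcases eq_or_ne x 0 with rfl | hx
  · rw [hasDerivAt_iff_tendsto_slope]
    have h : ContinuousAt (fun y : ℝ => |y| ^ (p - 2)) 0 :=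
      (continuous_abs.continuousAt).rpow_const (Or.inr (by linarith))
    have h2 := (h.tendsto.mono_left (nhdsWithin_le_nhds (s := {0}ᶜ)))
    simp only [abs_zero, Real.zero_rpow (show p - 2 ≠ 0 by linarith), mul_zero] at h2 ⊢
    refine h2.congr' ?_
    filter_upwards [self_mem_nhdsWithin] with y hy
    have hy : y ≠ 0 := hy
    rw [slope_def_field, phi, phi]
    field_simp
    simp
  · have h := (hasDerivAt_id x).mul ((hasDerivAt_abs hx).rpow_const (p := p - 2)
      (Or.inl (abs_ne_zero.2 hx)))
    have e : phi p = id * fun y : ℝ => |y| ^ (p - 2) := rfl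
    rw [e]
    refine h.congr_deriv ?_
    have h3 : x * (SignType.sign x : ℝ) = |x| := by
      rw [mul_comm]; exact sign_mul_self x
    have h4 : |x| ^ (p - 2) = |x| * |x| ^ (p - 2 - 1) := by
      rw [Real.rpow_sub_one (abs_ne_zero.2 hx)]
      field_simp [abs_ne_zero.2 hx]
    simp only [id]
    linear_combination (p - 2) * |x| ^ (p - 2 - 1) * h3 - (p - 2) * h4

theorem hasDerivAt_abs_rpow_phi {p : ℝ} (hp : 2 < p) (x : ℝ) :
    HasDerivAt (fun x : ℝ => |x| ^ p) (p * phi p x) x := by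
  convert hasDerivAt_abs_rpow x (show 1 < p by linarith) using 1
  rw [phi]; ring

theorem strictMono_phi {p : ℝ} (hp : 2 < p) : StrictMono (phi p) := by
  have hodd : ∀ x ≤ 0, phi p x = -(-x) ^ (p - 1) := fun x hx => by
    rw [← phi_of_nonneg hp (by linarith : 0 ≤ -x), phi_neg, neg_neg]
  refine StrictMonoOn.Iic_union_Ici (a := 0) ?_ ?_
  · intro x hx y hy hxy
    rw [hodd x hx, hodd y hy]
    exact neg_lt_neg (Real.rpow_lt_rpow (by simpa using hy) (by linarith) (by linarith))
  · intro x hx y hy hxy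
    rw [phi_of_nonneg hp hx, phi_of_nonneg hp hy]
    exact Real.rpow_lt_rpow hx hxy (by linarith)

/-! ### A nonnegativity criterion from convexity, and equality in Young's inequality -/

theorem ConvexOn.le_of_hasDerivAt_zero {S : Set ℝ} {g : ℝ → ℝ} {b x : ℝ} (hg : ConvexOn ℝ S g)
    (hb : b ∈ S) (hx : x ∈ S) (h : HasDerivAt g 0 b) : g b ≤ g x := by
  rcases lt_trichotomy b x with hbx | rfl | hbx
  · have := hg.le_slope_of_hasDerivAt hb hx hbx h
    rw [slope_def_field, le_div_iff₀ (by linarith)] at this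
    linarith
  · exact le_rfl
  · have := hg.slope_le_of_hasDerivAt hx hb hbx h
    rw [slope_def_field, div_le_iff₀ (by linarith)] at this
    linarith

/-- A function which is convex, then concave, then convex, and has double zeros in both convex
pieces, is nonnegative. -/
theorem nonneg_of_convex_concave_convex {g : ℝ → ℝ} {b s t c : ℝ} (hbs : b ≤ s) (hst : s ≤ t)
    (htc : t ≤ c) (h₁ : ConvexOn ℝ (Iic s) g) (h₂ : ConcaveOn ℝ (Icc s t) g)
    (h₃ : ConvexOn ℝ (Ici t) g) (hb : g b = 0) (hb' : HasDerivAt g 0 b) (hc : g c = 0)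
    (hc' : HasDerivAt g 0 c) (x : ℝ) : 0 ≤ g x := by
  have hl : ∀ x ≤ s, 0 ≤ g x := fun x hx => hb ▸ h₁.le_of_hasDerivAt_zero hbs hx hb'
  have hr : ∀ x, t ≤ x → 0 ≤ g x := fun x hx => hc ▸ h₃.le_of_hasDerivAt_zero htc hx hc'
  rcases le_total x s with hx | hx
  · exact hl x hx
  rcases le_total t x with hx' | hx'
  · exact hr x hx'
  · have := h₂.min_le_of_mem_Icc (left_mem_Icc.2 hst) (right_mem_Icc.2 hst) ⟨hx, hx'⟩
    exact (le_min (hl s le_rfl) (hr t le_rfl)).trans this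

/-- With `v` fixed, the Young deficit is nonnegative in its first argument and vanishes at `u`, so
`u` is a minimum and the derivative `φ(u) - v` is zero. -/
theorem eq_phi_of_young_eq {p q : ℝ} (hp : 2 < p) (hpq : p.HolderConjugate q) {u v : ℝ}
    (h : |u| ^ p / p + |v| ^ q / q - u * v = 0) : v = phi p u := by
  have hmin : IsLocalMin (fun s : ℝ => |s| ^ p / p + |v| ^ q / q - s * v) u :=
    Filter.Eventually.of_forall fun s => by
      have := Real.young_inequality s v hpq
      show |u| ^ p / p + |v| ^ q / q - u * v ≤ |s| ^ p / p + |v| ^ q / q - s * v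
      linarith
  have hd := ((((hasDerivAt_abs_rpow_phi hp u).div_const p).add_const (|v| ^ q / q)).sub
    ((hasDerivAt_id u).mul_const v))
  have := hmin.hasDerivAt_eq_zero hd
  rw [mul_div_cancel_left₀ _ (by linarith : p ≠ 0)] at this
  linarith

/-! ### Construction of the multipliers -/

/-- The functions of `(u, v)` whose averages are affine in the Bellman variables. -/
noncomputable def bellmanForm (p q : ℝ) (c : Fin 5 → ℝ) (u v : ℝ) : ℝ :=
  c 0 + c 1 * u + c 2 * |u| ^ p + c 3 * |v| ^ q + c 4 * (u * v)

/-- Lagrange multipliers certifying that `(u₁, v₁)` and `(u₂, v₂)` maximise `v`: a constraint form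
`d ≥ 0` and a form `c` which dominates `v` where `d` vanishes, both exact at the two points. -/
def HasMultipliers (p q u₁ v₁ u₂ v₂ : ℝ) : Prop :=
  ∃ d c : Fin 5 → ℝ, (∀ u v, 0 ≤ bellmanForm p q d u v) ∧
    (∀ u v, bellmanForm p q d u v = 0 → v ≤ bellmanForm p q c u v) ∧
    bellmanForm p q d u₁ v₁ = 0 ∧ bellmanForm p q d u₂ v₂ = 0 ∧
    bellmanForm p q c u₁ v₁ = v₁ ∧ bellmanForm p q c u₂ v₂ = v₂

theorem hasMultipliers_of_le {p q u₁ v₁ u₂ v₂ : ℝ} (c : Fin 5 → ℝ)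
    (h : ∀ u v, v ≤ bellmanForm p q c u v) (h₁ : bellmanForm p q c u₁ v₁ = v₁)
    (h₂ : bellmanForm p q c u₂ v₂ = v₂) : HasMultipliers p q u₁ v₁ u₂ v₂ :=
  ⟨0, c, fun u v => by simp [bellmanForm], fun u v _ => h u v, by simp [bellmanForm],
    by simp [bellmanForm], h₁, h₂⟩

/-- The second derivative has the sign of `m|x| - |1 - k + kx|`. Since `k < 1 ≤ m`, it changes sign
only at `-(1-k)/(m+k)` and `(1-k)/(m-k)`, and the double zeros `b` and `1` lie in the two outer,
convex pieces. -/
theorem rpow_difference_nonneg {p k m W C₀ b : ℝ} (hp : 2 < p) (hk : 0 < k) (hk1 : k < 1)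
    (hm : 1 ≤ m) (hW : W = k ^ 2 * m ^ (p - 2)) (hb : b ≤ -(1 - k) / (m + k))
    (hb' : k - W + W * phi p b - k * phi p (1 - k + k * b) = 0)
    (h1 : C₀ + (k - W) + (W - 1) / p = 0)
    (hb0 : C₀ + (k - W) * b + (W * |b| ^ p - |1 - k + k * b| ^ p) / p = 0) (x : ℝ) :
    0 ≤ C₀ + (k - W) * x + (W * |x| ^ p - |1 - k + k * x| ^ p) / p := by
  have hp0 : p ≠ 0 := by linarith
  have hmk : 0 < m - k := by linarith
  have hmk' : 0 < m + k := by linarith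
  have hlin : ∀ x : ℝ, HasDerivAt (fun x : ℝ => 1 - k + k * x) k x := fun x => by
    simpa using ((hasDerivAt_id x).const_mul k).const_add (1 - k)
  have hd : ∀ x : ℝ, HasDerivAt
      (fun x : ℝ => C₀ + (k - W) * x + (W * |x| ^ p - |1 - k + k * x| ^ p) / p)
      (k - W + W * phi p x - k * phi p (1 - k + k * x)) x := fun x => by
    have h := (((hasDerivAt_id x).const_mul (k - W)).const_add C₀).add
      ((((hasDerivAt_abs_rpow_phi hp x).const_mul W).sub
        ((hasDerivAt_abs_rpow_phi hp (1 - k + k * x)).comp x (hlin x))).div_const p)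
    convert! h using 1
    field_simp
    ring
  have hd2 : ∀ x : ℝ, HasDerivAt (fun x : ℝ => k - W + W * phi p x - k * phi p (1 - k + k * x))
      ((p - 1) * k ^ 2 * ((m * |x|) ^ (p - 2) - |1 - k + k * x| ^ (p - 2))) x := fun x => by
    have h := (((hasDerivAt_phi hp x).const_mul W).const_add (k - W)).sub
        (((hasDerivAt_phi hp (1 - k + k * x)).comp x (hlin x)).const_mul k)
    convert! h using 1
    rw [Real.mul_rpow (by linarith) (abs_nonneg x), hW]
    ring
  have hpos : ∀ x : ℝ, |1 - k + k * x| ≤ m * |x| →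
      0 ≤ (p - 1) * k ^ 2 * ((m * |x|) ^ (p - 2) - |1 - k + k * x| ^ (p - 2)) := fun x hx =>
    mul_nonneg (mul_nonneg (by linarith) (sq_nonneg k))
      (sub_nonneg.2 (Real.rpow_le_rpow (abs_nonneg _) hx (by linarith)))
  have hneg : ∀ x : ℝ, m * |x| ≤ |1 - k + k * x| →
      (p - 1) * k ^ 2 * ((m * |x|) ^ (p - 2) - |1 - k + k * x| ^ (p - 2)) ≤ 0 := fun x hx =>
    mul_nonpos_of_nonneg_of_nonpos (mul_nonneg (by linarith) (sq_nonneg k))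
      (sub_nonpos.2 (Real.rpow_le_rpow (mul_nonneg (by linarith) (abs_nonneg _)) hx
        (by linarith)))
  have hcont : Continuous
      (fun x : ℝ => C₀ + (k - W) * x + (W * |x| ^ p - |1 - k + k * x| ^ p) / p) :=
    continuous_iff_continuousAt.2 fun x => (hd x).continuousAt
  have hs0 : -(1 - k) / (m + k) ≤ 0 := div_nonpos_of_nonpos_of_nonneg (by linarith) hmk'.le
  have ht0 : 0 ≤ (1 - k) / (m - k) := div_nonneg (by linarith) hmk.le
  refine nonneg_of_convex_concave_convex
    (g := fun x : ℝ => C₀ + (k - W) * x + (W * |x| ^ p - |1 - k + k * x| ^ p) / p) (b := b) (s := -(1 - k) / (m + k))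
    (t := (1 - k) / (m - k)) (c := 1) hb (hs0.trans ht0) ?_ ?_ ?_ ?_ hb0 ?_ ?_ ?_ x
  · rw [div_le_one hmk]; linarith
  · refine convexOn_of_hasDerivWithinAt2_nonneg (convex_Iic _) hcont.continuousOn
      (fun x _ => (hd x).hasDerivWithinAt) (fun x _ => (hd2 x).hasDerivWithinAt)
      fun x hx => hpos x ?_
    rw [interior_Iic] at hx
    have hx' : x < -(1 - k) / (m + k) := hx
    rw [lt_div_iff₀ hmk'] at hx'
    have hx0 : x < 0 := lt_of_lt_of_le hx hs0
    rw [abs_of_neg hx0, abs_le]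
    constructor <;> nlinarith
  · refine concaveOn_of_hasDerivWithinAt2_nonpos (convex_Icc _ _) hcont.continuousOn
      (fun x _ => (hd x).hasDerivWithinAt) (fun x _ => (hd2 x).hasDerivWithinAt)
      fun x hx => hneg x ?_
    rw [interior_Icc] at hx
    have hx1 := hx.1
    have hx2 := hx.2
    rw [div_lt_iff₀ hmk'] at hx1
    rw [lt_div_iff₀ hmk] at hx2
    refine le_trans ?_ (le_abs_self _)
    rcases abs_cases x with ⟨h, _⟩ | ⟨h, _⟩ <;> rw [h] <;> linarith
  · refine convexOn_of_hasDerivWithinAt2_nonneg (convex_Ici _) hcont.continuousOn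
      (fun x _ => (hd x).hasDerivWithinAt) (fun x _ => (hd2 x).hasDerivWithinAt)
      fun x hx => hpos x ?_
    rw [interior_Ici] at hx
    have hx' : (1 - k) / (m - k) < x := hx
    rw [div_lt_iff₀ hmk] at hx'
    have hx0 : 0 < x := ht0.trans_lt hx
    rw [abs_of_pos hx0, abs_of_nonneg (by nlinarith)]
    linarith
  · rw [← hb']; exact hd b
  · simpa using h1
  · convert! hd 1 using 1
    simp [phi_one]

theorem lam_of_ne {p R : ℝ} (hR : R ≠ -1) : lam p R = 1 / (1 + R) - (p - 1) / (1 + phi p R) :=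
  if_neg hR

theorem one_add_phi_pos {p R : ℝ} (hp : 2 < p) (hR : -1 < R) : 0 < 1 + phi p R := by
  have := strictMono_phi hp hR
  rw [phi_neg, phi_one] at this
  linarith

theorem phi_le_self {p r : ℝ} (hp : 2 < p) (hr : 0 ≤ r) (hr1 : r ≤ 1) : phi p r ≤ r := by
  rw [phi_of_nonneg hp hr]
  simpa using Real.rpow_le_rpow_of_exponent_ge' hr hr1 zero_le_one (by linarith : 1 ≤ p - 1)

theorem hasMultipliers_neg_one {p q r : ℝ} (hpq : p.HolderConjugate q) :
    HasMultipliers p q 1 1 (-r) (-phi p (-1)) := by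
  have h := hpq.inv_add_inv_eq_one
  rw [phi_neg, phi_one, neg_neg]
  refine hasMultipliers_of_le ![1 / p, 0, 0, 1 / q, 0] (fun u v => ?_) ?_ ?_
  · have := Real.young_inequality 1 v hpq
    simp only [abs_one, Real.one_rpow, one_mul] at this
    simp [bellmanForm]
    rw [div_eq_mul_inv, div_eq_mul_inv] at this
    linarith
  · simp [bellmanForm, h]
  · simp [bellmanForm, h]

theorem hasMultipliers_of_lam_eq {p q R r : ℝ} (hp : 2 < p) (hpq : p.HolderConjugate q)
    (hR : -1 < R) (hRr : R < r) (hr1 : r ≤ 1) (habs : |R| ≤ r) (hlam : lam p r = lam p R) :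
    HasMultipliers p q 1 1 (-r) (-phi p R) := by
  have hr : 0 ≤ r := (abs_nonneg R).trans habs
  have hp0 : p ≠ 0 := by linarith
  have hq0 : q ≠ 0 := hpq.symm.pos.ne'
  have hqi : q⁻¹ = 1 - p⁻¹ := by linarith [hpq.inv_add_inv_eq_one]
  have ha : 0 < 1 + R := by linarith
  have hb : 0 < 1 + r := by linarith
  have hx : 0 < 1 + phi p R := one_add_phi_pos hp hR
  have hy : 0 < 1 + phi p r := one_add_phi_pos hp (by linarith)
  have hxy : phi p R < phi p r := strictMono_phi hp hRr
  have hyr := phi_le_self hp hr hr1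
  have hlam' : (1 + phi p R) * (1 + phi p r) * (r - R)
      = (p - 1) * (phi p r - phi p R) * ((1 + R) * (1 + r)) := by
    rw [lam_of_ne (by linarith), lam_of_ne (by linarith)] at hlam
    field_simp at hlam
    linear_combination -hlam
  -- This is `θ ≥ 1` for the `θ` below, which gives `m ≥ 1`; it rests on `φ(r) ≤ r` and `p - 1 > 1`.
  have hkey : (1 + R) * (1 + phi p r) ≤ (1 + phi p R) * (1 + r) := by
    have : 0 ≤ (1 + phi p r) * ((1 + phi p R) * (1 + r) - (1 + R) * (1 + phi p r)) := by
      have e : (1 + phi p r) * ((1 + phi p R) * (1 + r) - (1 + R) * (1 + phi p r))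
          = (1 + R) * (phi p r - phi p R) * ((p - 1) * (1 + r) - (1 + phi p r)) := by
        linear_combination hlam'
      rw [e]
      exact mul_nonneg (mul_nonneg ha.le (by linarith)) (by nlinarith)
    linarith [nonneg_of_mul_nonneg_right this hy]
  -- Equality in Young's inequality for `1 - k + ku` and `v` must hold at `(-r, -φ(R))`, so `1 - k -
  -- kr = -R`; this fixes `k`. Then `W` is fixed by the vanishing derivative at `-r`, and `m`
  -- normalises `W = k² m^(p-2)`.
  set k := (1 + R) / (1 + r) with hk_def
  set θ := (1 + phi p R) * (1 + r) / ((1 + R) * (1 + phi p r)) with hθ_def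
  set m := θ ^ (p - 2)⁻¹ with hm_def
  set W := k ^ 2 * θ with hW_def
  have hk0 : 0 < k := div_pos ha hb
  have hk1 : k < 1 := (div_lt_one hb).2 (by linarith)
  have hθ : 1 ≤ θ := (one_le_div (mul_pos ha hy)).2 hkey
  have hm : 1 ≤ m := Real.one_le_rpow hθ (inv_nonneg.2 (by linarith))
  have hmθ : m ^ (p - 2) = θ := by
    rw [hm_def, ← Real.rpow_mul (by linarith), inv_mul_cancel₀ (by linarith), Real.rpow_one]
  have hu : 1 - k + k * -r = -R := by
    rw [hk_def]; field_simp; ring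
  have hWv : W = (1 + R) * (1 + phi p R) / ((1 + r) * (1 + phi p r)) := by
    rw [hW_def, hk_def, hθ_def]; field_simp
  have hrp : |(-r)| ^ p = r * phi p r := by rw [abs_neg, mul_phi hp]
  have hRp : |(-R)| ^ p = R * phi p R := by rw [abs_neg, mul_phi hp]
  -- The vanishing at `-r`: after clearing denominators this is `λ(r) = λ(R)`.
  have hzero : W - k - (W - 1) / p + (k - W) * -r + (W * |(-r)| ^ p - |(-R)| ^ p) / p = 0 := by
    rw [hrp, hRp, hWv, hk_def]
    field_simp
    linear_combination hlam'
  have hnonneg := rpow_difference_nonneg (b := -r) (W := W) (C₀ := W - k - (W - 1) / p) hp hk0 hk1 hm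
    (by rw [hmθ]) (by
      -- As `1 - k = kr - R`, the claim `-r ≤ -(1-k)/(m+k)` reduces to `-R ≤ mr`, which follows from
      -- `|R| ≤ r` and `m ≥ 1`.
      rw [le_div_iff₀ (by linarith)]
      nlinarith [le_abs_self R, neg_abs_le R]) (by
      rw [hu, phi_neg, phi_neg, hWv, hk_def]
      field_simp
      ring) (by ring) (by rw [hu]; exact hzero)
  have hk1' : 0 < 1 - k := by linarith
  refine hasMultipliers_of_le ![(W - k - (W - 1) / p) / (1 - k), (k - W) / (1 - k),
    W / p / (1 - k), 1 / q / (1 - k), -k / (1 - k)] (fun u v => ?_) ?_ ?_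
  · have h1 := hnonneg u
    have h2 := Real.young_inequality (1 - k + k * u) v hpq
    have e : bellmanForm p q ![(W - k - (W - 1) / p) / (1 - k), (k - W) / (1 - k),
        W / p / (1 - k), 1 / q / (1 - k), -k / (1 - k)] u v =
        ((W - k - (W - 1) / p) + (k - W) * u + W / p * |u| ^ p + |v| ^ q / q - k * (u * v))
          / (1 - k) := by
      simp [bellmanForm]; ring
    rw [e, le_div_iff₀ hk1']
    have e2 : (W * |u| ^ p - |1 - k + k * u| ^ p) / p
      = W / p * |u| ^ p - |1 - k + k * u| ^ p / p := by ring
    rw [e2] at h1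
    linarith
  · simp [bellmanForm, hqi]
    field_simp
    ring
  · simp only [bellmanForm]
    rw [abs_neg (phi p R), abs_phi_rpow hp hpq, ← mul_phi hp R, hrp]
    rw [hrp, hRp] at hzero
    have e1 : k * (1 + r) = 1 + R := by rw [hk_def]; field_simp
    simp [hqi]
    field_simp
    field_simp at hzero
    linear_combination hzero - p * phi p R * e1

theorem IsCriticalRadius.one_add_rpow_eq {p r : ℝ} (hr : IsCriticalRadius p r) :
    1 + r ^ (p - 1) = (p - 1) * r ^ ((p - 2) / 2) * (1 + r) := by
  obtain ⟨⟨h0, -⟩, h⟩ := hr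
  have h' := congrArg (r ^ ((p - 1) / 2) * ·) h
  simp only [mul_add, mul_left_comm _ (p - 1), ← Real.rpow_add h0] at h'
  rw [show (p - 1) / 2 + (p - 1) / 2 = p - 1 by ring, add_neg_cancel, Real.rpow_zero,
    show (p - 1) / 2 + 1 / 2 = (p - 2) / 2 + 1 by ring,
    show (p - 1) / 2 + -(1 / 2) = (p - 2) / 2 by ring, Real.rpow_add h0, Real.rpow_one] at h'
  linear_combination h'

/-- The difference of the two sides has second derivative `(p-1)|u|^(p-3) (D|u| - (p-2) sign u)` off
`0`: it is convex up to `0`, concave up to `(p-2)/D`, and convex afterwards. The bound `p - 2 ≤ D`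
places the double zero `1` in the last piece. -/
theorem phi_le_of_double_zeros {p r c₀ c₁ D : ℝ} (hp : 2 < p) (hr : 0 ≤ r) (hD : p - 2 ≤ D)
    (h1' : c₁ + D - (p - 1) = 0) (hr' : c₁ - D * phi p r - (p - 1) * r ^ (p - 2) = 0)
    (h1 : c₀ + c₁ + D / p - 1 = 0) (hr0 : c₀ - c₁ * r + D / p * |r| ^ p + phi p r = 0) (u : ℝ) :
    phi p u ≤ c₀ + c₁ * u + D / p * |u| ^ p := by
  have hp0 : p ≠ 0 := by linarith
  have hD0 : 0 < D := by linarith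
  have hd : ∀ u : ℝ, HasDerivAt (fun u : ℝ => c₀ + c₁ * u + D / p * |u| ^ p - phi p u)
      (c₁ + D * phi p u - (p - 1) * |u| ^ (p - 2)) u := fun u => by
    have h := ((((hasDerivAt_id u).const_mul c₁).const_add c₀).add
      ((hasDerivAt_abs_rpow_phi hp u).const_mul (D / p))).sub (hasDerivAt_phi hp u)
    convert! h using 1
    field_simp
  have hd2 : ∀ u : ℝ, u ≠ 0 → HasDerivAt
      (fun u : ℝ => c₁ + D * phi p u - (p - 1) * |u| ^ (p - 2))
      ((p - 1) * |u| ^ (p - 3) * (D * |u| - (p - 2) * (SignType.sign u : ℝ))) u := fun u hu => by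
    have h := (((hasDerivAt_phi hp u).const_mul D).const_add c₁).sub
      (((hasDerivAt_abs hu).rpow_const (p := p - 2) (Or.inl (abs_ne_zero.2 hu))).const_mul (p - 1))
    convert! h using 1
    have e : |u| ^ (p - 2) = |u| ^ (p - 3) * |u| := by
      rw [← Real.rpow_add_one (abs_ne_zero.2 hu)]; congr 1; ring
    rw [e, show p - 2 - 1 = p - 3 by ring]
    ring
  have hcont : Continuous (fun u : ℝ => c₀ + c₁ * u + D / p * |u| ^ p - phi p u) :=
    continuous_iff_continuousAt.2 fun x => (hd x).continuousAt
  have hcoef : ∀ u : ℝ, 0 ≤ (p - 1) * |u| ^ (p - 3) := fun u =>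
    mul_nonneg (by linarith) (Real.rpow_nonneg (abs_nonneg u) _)
  have ht0 : 0 ≤ (p - 2) / D := div_nonneg (by linarith) hD0.le
  suffices h : 0 ≤ c₀ + c₁ * u + D / p * |u| ^ p - phi p u by linarith
  refine nonneg_of_convex_concave_convex
    (g := fun u : ℝ => c₀ + c₁ * u + D / p * |u| ^ p - phi p u) (b := -r) (s := 0)
    (t := (p - 2) / D) (c := 1) (by linarith) ht0 ((div_le_one hD0).2 hD) ?_ ?_ ?_ ?_ ?_ ?_ ?_ u
  · refine convexOn_of_hasDerivWithinAt2_nonneg (convex_Iic _) hcont.continuousOn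
      (fun x _ => (hd x).hasDerivWithinAt)
      (fun x hx => (hd2 x (ne_of_lt (by simpa using hx))).hasDerivWithinAt)
      fun x hx => mul_nonneg (hcoef x) ?_
    have hx : x < 0 := by simpa using hx
    rw [sign_neg hx]
    have := mul_nonneg hD0.le (abs_nonneg x)
    simp only [SignType.coe_neg_one]
    linarith
  · refine concaveOn_of_hasDerivWithinAt2_nonpos (convex_Icc _ _) hcont.continuousOn
      (fun x _ => (hd x).hasDerivWithinAt)
      (fun x hx => (hd2 x (by rw [interior_Icc] at hx; exact hx.1.ne')).hasDerivWithinAt)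
      fun x hx => mul_nonpos_of_nonneg_of_nonpos (hcoef x) ?_
    rw [interior_Icc] at hx
    have h2 := hx.2
    rw [lt_div_iff₀ hD0] at h2
    rw [sign_pos hx.1, abs_of_pos hx.1]
    simp only [SignType.coe_one]
    linarith
  · have hpos : ∀ x ∈ interior (Ici ((p - 2) / D)), 0 < x := fun x hx => by
      rw [interior_Ici] at hx
      exact ht0.trans_lt hx
    refine convexOn_of_hasDerivWithinAt2_nonneg (convex_Ici _) hcont.continuousOn
      (fun x _ => (hd x).hasDerivWithinAt)
      (fun x hx => (hd2 x (hpos x hx).ne').hasDerivWithinAt)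
      fun x hx => mul_nonneg (hcoef x) ?_
    have h0 := hpos x hx
    rw [interior_Ici] at hx
    have h2 : (p - 2) / D < x := hx
    rw [div_lt_iff₀ hD0] at h2
    rw [sign_pos h0, abs_of_pos h0]
    simp only [SignType.coe_one]
    linarith
  · simp only [phi_neg, abs_neg]
    linarith
  · convert! hd (-r) using 1
    rw [phi_neg, abs_neg, abs_of_nonneg hr]
    linarith
  · simp only [abs_one, Real.one_rpow, phi_one]
    linarith
  · convert! hd 1 using 1
    simp only [abs_one, Real.one_rpow, phi_one]
    linarith

theorem hasMultipliers_of_isCriticalRadius {p q r : ℝ} (hp : 2 < p) (hpq : p.HolderConjugate q)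
    (hr : IsCriticalRadius p r) : HasMultipliers p q 1 1 (-r) (-phi p r) := by
  obtain ⟨hr0, hr1⟩ := hr.1
  have hp0 : p ≠ 0 := by linarith
  have hp1 : p - 1 ≠ 0 := by linarith
  have hq0 : q ≠ 0 := hpq.symm.pos.ne'
  have hqi : q⁻¹ = 1 - p⁻¹ := by linarith [hpq.inv_add_inv_eq_one]
  have hcrit := hr.one_add_rpow_eq
  have ht1 : r ^ ((p - 2) / 2) ≤ 1 := Real.rpow_le_one hr0.le hr1.le (by linarith)
  have ht0 : 0 < r ^ ((p - 2) / 2) := Real.rpow_pos_of_pos hr0 _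
  have h2 : r ^ (p - 2) = (r ^ ((p - 2) / 2)) ^ 2 := by
    rw [← Real.rpow_natCast, ← Real.rpow_mul hr0.le]; congr 1; push_cast; ring
  have hphi : phi p r = (r ^ ((p - 2) / 2)) ^ 2 * r := by
    rw [← h2, phi, abs_of_pos hr0]; ring
  rw [← phi_of_nonneg hp hr0.le, hphi] at hcrit
  set t := r ^ ((p - 2) / 2) with ht
  have hE : 0 < 1 + t ^ 2 * r := by positivity
  have hpow : |r| ^ p = t ^ 2 * r ^ 2 := by rw [← mul_phi hp, hphi]; ring
  -- The double zero at `1` expresses `c₀` and `c₁` through `D`; the vanishing derivative at `-r`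
  -- gives this `D`.
  set D := (p - 1) * (1 - t ^ 2) / (1 + t ^ 2 * r) with hD
  have hDE : D * (1 + t ^ 2 * r) = (p - 1) * (1 - t ^ 2) := by rw [hD]; field_simp
  have hDp : p - 2 ≤ D := by
    rw [hD, le_div_iff₀ hE]
    have : 0 ≤ (p - 1) * (1 + r) * (t * (1 - t)) := by
      have : 0 ≤ 1 - t := by linarith
      have : 0 ≤ p - 1 := by linarith
      positivity
    linarith
  -- The remaining condition, the vanishing at `-r`, is where the equation of the critical radius
  -- enters.
  have hzero : (1 - (p - 1 - D) - D / p) - (p - 1 - D) * r + D / p * (t ^ 2 * r ^ 2) + t ^ 2 * r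
      = 0 := by
    rw [hD]
    field_simp
    linear_combination (1 + t ^ 2 * r + (p - 1) * t * (1 + r)) * hcrit
  have hle := phi_le_of_double_zeros (c₀ := 1 - (p - 1 - D) - D / p) (c₁ := p - 1 - D) hp hr0.le
    hDp (by ring) (by rw [hphi, h2]; linear_combination -hDE) (by ring)
    (by rw [hphi, hpow]; exact hzero)
  -- The constraint form is the Young deficit, whose zero set is the curve `v = φ(u)`.
  refine ⟨![0, 0, 1 / p, 1 / q, -1], ![1 - (p - 1 - D) - D / p, p - 1 - D, D / p, 0, 0],
    fun u v => ?_, fun u v huv => ?_, ?_, ?_, ?_, ?_⟩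
  · have := Real.young_inequality u v hpq
    simp [bellmanForm]
    rw [div_eq_inv_mul, div_eq_inv_mul] at this
    linarith
  · have : v = phi p u := by
      refine eq_phi_of_young_eq hp hpq ?_
      rw [← huv]
      simp [bellmanForm]
      ring
    rw [this]
    simpa [bellmanForm] using hle u
  · simp [bellmanForm, hqi]
  · simp only [bellmanForm]
    rw [abs_neg (phi p r), abs_phi_rpow hp hpq, abs_neg, ← mul_phi hp]
    simp [hqi]
    ring
  · simp [bellmanForm]
    ring
  · simp [bellmanForm, hpow, hphi]
    linear_combination hzero

/-! ### The critical radius, monotonicity of `λ`, and the function `ρ` -/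

/-- With `R = e^(-2τ)` the function is `2 cosh((p-1)τ) - 2(p-1) cosh τ`, which increases in `τ ≥ 0`
because `sinh((p-1)τ) > sinh τ` for `τ > 0`. -/
theorem strictAntiOn_rpow_cosh_sub {p : ℝ} (hp : 2 < p) :
    StrictAntiOn (fun R : ℝ => R ^ ((p - 1) / 2) + R ^ (-((p - 1) / 2))
      - (p - 1) * (R ^ ((1 : ℝ) / 2) + R ^ (-((1 : ℝ) / 2)))) (Ioc 0 1) := by
  have hd : ∀ R : ℝ, 0 < R → HasDerivAt (fun R : ℝ => R ^ ((p - 1) / 2) + R ^ (-((p - 1) / 2))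
      - (p - 1) * (R ^ ((1 : ℝ) / 2) + R ^ (-((1 : ℝ) / 2))))
      ((p - 1) / (2 * R) * (R ^ ((p - 1) / 2) - R ^ (-((p - 1) / 2))
        - (R ^ ((1 : ℝ) / 2) - R ^ (-((1 : ℝ) / 2))))) R := fun R hR => by
    have h (s : ℝ) := Real.hasDerivAt_rpow_const (x := R) (p := s) (Or.inl hR.ne')
    refine (((h ((p - 1) / 2)).add (h (-((p - 1) / 2)))).sub
      (((h (1 / 2)).add (h (-(1 / 2)))).const_mul (p - 1))).congr_deriv ?_
    simp only [Real.rpow_sub_one hR.ne']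
    field_simp
    ring
  refine strictAntiOn_of_hasDerivWithinAt_neg (convex_Ioc 0 1)
    (fun x hx => (hd x hx.1).continuousAt.continuousWithinAt)
    (fun x hx => (hd x (by rw [interior_Ioc] at hx; exact hx.1)).hasDerivWithinAt)
    fun x hx => ?_
  rw [interior_Ioc] at hx
  refine mul_neg_of_pos_of_neg (div_pos (by linarith) (by linarith [hx.1])) ?_
  have h1 := Real.rpow_lt_rpow_of_exponent_gt hx.1 hx.2 (show 1 / 2 < (p - 1) / 2 by linarith)
  have h2 := Real.rpow_lt_rpow_of_exponent_gt hx.1 hx.2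
    (show -((p - 1) / 2) < -(1 / 2) by linarith)
  linarith

/-- With `s = e^(-2τ)` this is `(p-1) sinh τ ≤ sinh((p-1)τ)`, proved by differentiating in `s` and
comparing with the value at `s = 1`. -/
theorem mul_rpow_mul_one_sub_le {p s : ℝ} (hp : 2 < p) (hs : 0 ≤ s) (hs1 : s ≤ 1) :
    (p - 1) * s ^ ((p - 2) / 2) * (1 - s) ≤ 1 - s ^ (p - 1) := by
  rcases hs.eq_or_lt with rfl | hs0
  · rw [Real.zero_rpow (by linarith), Real.zero_rpow (by linarith)]; simp
  have hd : ∀ R : ℝ, 0 < R → HasDerivAt (fun R : ℝ => R ^ (-((p - 1) / 2)) - R ^ ((p - 1) / 2)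
      - (p - 1) * (R ^ (-((1 : ℝ) / 2)) - R ^ ((1 : ℝ) / 2)))
      (-((p - 1) / (2 * R) * (R ^ (-((p - 1) / 2)) + R ^ ((p - 1) / 2)
        - (R ^ (-((1 : ℝ) / 2)) + R ^ ((1 : ℝ) / 2))))) R := fun R hR => by
    have h (s : ℝ) := Real.hasDerivAt_rpow_const (x := R) (p := s) (Or.inl hR.ne')
    refine (((h (-((p - 1) / 2))).sub (h ((p - 1) / 2))).sub
      (((h (-(1 / 2))).sub (h (1 / 2))).const_mul (p - 1))).congr_deriv ?_
    simp only [Real.rpow_sub_one hR.ne']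
    field_simp
    ring
  have hanti := antitoneOn_of_hasDerivWithinAt_nonpos (convex_Ioc 0 1)
    (fun x hx => (hd x hx.1).continuousAt.continuousWithinAt)
    (fun x hx => (hd x (by rw [interior_Ioc] at hx; exact hx.1)).hasDerivWithinAt)
    fun x hx => by
      rw [interior_Ioc] at hx
      refine neg_nonpos.2 (mul_nonneg (div_nonneg (by linarith) (by linarith [hx.1])) ?_)
      have hx1 := Real.rpow_pos_of_pos hx.1 (1 / 2)
      have hx2 := Real.rpow_pos_of_pos hx.1 ((p - 1) / 2)
      have h1 := Real.rpow_le_rpow_of_exponent_ge hx.1 hx.2.le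
        (show 1 / 2 ≤ (p - 1) / 2 by linarith)
      have h2 : x ^ ((1 : ℝ) / 2) ≤ 1 := Real.rpow_le_one hx.1.le hx.2.le (by norm_num)
      have e : x ^ (-((p - 1) / 2)) + x ^ ((p - 1) / 2)
          - (x ^ (-((1 : ℝ) / 2)) + x ^ ((1 : ℝ) / 2))
          = (x ^ ((1 : ℝ) / 2) - x ^ ((p - 1) / 2)) * (1 - x ^ ((1 : ℝ) / 2) * x ^ ((p - 1) / 2))
            / (x ^ ((1 : ℝ) / 2) * x ^ ((p - 1) / 2)) := by
        rw [Real.rpow_neg hx.1.le, Real.rpow_neg hx.1.le]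
        field_simp
        ring
      rw [e]
      refine div_nonneg (mul_nonneg (by linarith) ?_) (by positivity)
      nlinarith
  have h := hanti ⟨hs0, hs1⟩ (right_mem_Ioc.2 zero_lt_one) hs1
  simp only [Real.one_rpow, sub_self, mul_zero] at h
  have h' := mul_nonneg (Real.rpow_nonneg hs ((p - 1) / 2)) h
  simp only [mul_sub, mul_left_comm _ (p - 1), ← Real.rpow_add hs0] at h'
  rw [show (p - 1) / 2 + (p - 1) / 2 = p - 1 by ring, add_neg_cancel, Real.rpow_zero,
    show (p - 1) / 2 + 1 / 2 = (p - 2) / 2 + 1 by ring,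
    show (p - 1) / 2 + -(1 / 2) = (p - 2) / 2 by ring, Real.rpow_add hs0, Real.rpow_one] at h'
  linarith

theorem one_add_rpow_sub_eq {p R : ℝ} (hR : 0 < R) :
    1 + R ^ (p - 1) - (p - 1) * R ^ ((p - 2) / 2) * (1 + R) =
      R ^ ((p - 1) / 2) * (R ^ ((p - 1) / 2) + R ^ (-((p - 1) / 2))
      - (p - 1) * (R ^ ((1 : ℝ) / 2) + R ^ (-((1 : ℝ) / 2)))) := by
  simp only [mul_sub, mul_add, mul_left_comm _ (p - 1), ← Real.rpow_add hR]
  rw [show (p - 1) / 2 + (p - 1) / 2 = p - 1 by ring, add_neg_cancel, Real.rpow_zero,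
    show (p - 1) / 2 + 1 / 2 = (p - 2) / 2 + 1 by ring,
    show (p - 1) / 2 + -(1 / 2) = (p - 2) / 2 by ring, Real.rpow_add hR, Real.rpow_one]
  ring

theorem isCriticalRadius_R0 {p : ℝ} (hp : 2 < p) : IsCriticalRadius p (R0 p) := by
  refine Classical.epsilon_spec (p := IsCriticalRadius p) ?_
  -- Multiplying the critical equation by `R^((p-1)/2)` removes the singularity at `0`, so the
  -- intermediate value theorem applies on `[0,1]`.
  have hc : Continuous fun R : ℝ => 1 + R ^ (p - 1) - (p - 1) * R ^ ((p - 2) / 2) * (1 + R) := by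
    have h1 := Real.continuous_rpow_const (q := p - 1) (by linarith)
    have h2 := Real.continuous_rpow_const (q := (p - 2) / 2) (by linarith)
    fun_prop
  obtain ⟨r, hr, hr'⟩ := intermediate_value_Ioo' zero_le_one hc.continuousOn
    (show (0 : ℝ) ∈ Ioo _ _ by
      rw [Real.zero_rpow (by linarith), Real.zero_rpow (by linarith), Real.one_rpow, Real.one_rpow]
      constructor <;> linarith)
  refine ⟨r, hr, ?_⟩
  have h := one_add_rpow_sub_eq (p := p) hr.1
  rw [show 1 + r ^ (p - 1) - (p - 1) * r ^ ((p - 2) / 2) * (1 + r) = 0 from hr', eq_comm,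
    mul_eq_zero] at h
  rcases h with h | h
  · exact absurd h (Real.rpow_pos_of_pos hr.1 _).ne'
  · linarith

theorem IsCriticalRadius.lt_of_lt {p r R : ℝ} (hp : 2 < p) (hr : IsCriticalRadius p r)
    (hR : 0 < R) (hRr : R < r) : (p - 1) * R ^ ((p - 2) / 2) * (1 + R) < 1 + R ^ (p - 1) := by
  have h := strictAntiOn_rpow_cosh_sub hp ⟨hR, by linarith [hr.1.2]⟩ ⟨hr.1.1, hr.1.2.le⟩ hRr
  simp only [hr.2, sub_self] at h
  have h' := mul_pos (Real.rpow_pos_of_pos hR ((p - 1) / 2)) h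
  rw [← one_add_rpow_sub_eq hR] at h'
  linarith

theorem IsCriticalRadius.lt_of_gt {p r R : ℝ} (hp : 2 < p) (hr : IsCriticalRadius p r)
    (hR : r < R) (hR1 : R ≤ 1) :
    1 + R ^ (p - 1) < (p - 1) * R ^ ((p - 2) / 2) * (1 + R) := by
  have hR0 : 0 < R := hr.1.1.trans hR
  have h := strictAntiOn_rpow_cosh_sub hp ⟨hr.1.1, hr.1.2.le⟩ ⟨hR0, hR1⟩ hR
  simp only [hr.2, sub_self] at h
  have h' := mul_neg_of_pos_of_neg (Real.rpow_pos_of_pos hR0 ((p - 1) / 2)) h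
  rw [← one_add_rpow_sub_eq hR0] at h'
  linarith

/-- In this form the derivative is a difference of squares, so its sign is that of
`(p-1)|R|^((p-2)/2)(1+R) - (1+φ(R))`. -/
theorem hasDerivAt_lam {p R : ℝ} (hp : 2 < p) (hR : -1 < R) :
    HasDerivAt (lam p) (-1 / (1 + R) ^ 2 +
      ((p - 1) * |R| ^ ((p - 2) / 2)) ^ 2 / (1 + phi p R) ^ 2) R := by
  have hx := one_add_phi_pos hp hR
  have h : HasDerivAt (fun R => 1 / (1 + R) - (p - 1) / (1 + phi p R)) (-1 / (1 + R) ^ 2 +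
      ((p - 1) * |R| ^ ((p - 2) / 2)) ^ 2 / (1 + phi p R) ^ 2) R := by
    have h1 := ((hasDerivAt_id R).const_add 1).inv (by simp; linarith)
    have h2 := (((hasDerivAt_phi hp R).const_add 1).inv hx.ne').const_mul (p - 1)
    convert! h1.sub h2 using 1
    · ext x; simp [div_eq_mul_inv]
    · have e : |R| ^ (p - 2) = (|R| ^ ((p - 2) / 2)) ^ 2 := by
        rw [← Real.rpow_natCast, ← Real.rpow_mul (abs_nonneg R)]; congr 1; push_cast; ring
      rw [e]
      simp
      ring
  refine h.congr_of_eventuallyEq ?_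
  filter_upwards [lt_mem_nhds hR] with x hx
  exact lam_of_ne hx.ne'

theorem mul_rpow_mul_one_add_le {p R : ℝ} (hp : 2 < p) (hR : -1 < R) (hR0 : R < R0 p) :
    (p - 1) * |R| ^ ((p - 2) / 2) * (1 + R) ≤ 1 + phi p R := by
  rcases lt_or_ge 0 R with h | h
  · rw [abs_of_pos h, phi_of_nonneg hp h.le]
    exact ((isCriticalRadius_R0 hp).lt_of_lt hp h hR0).le
  · have := mul_rpow_mul_one_sub_le hp (neg_nonneg.2 h) (by linarith)
    rw [← phi_of_nonneg hp (neg_nonneg.2 h), phi_neg] at this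
    rw [abs_of_nonpos h]
    linarith

theorem antitoneOn_lam {p : ℝ} (hp : 2 < p) : AntitoneOn (lam p) (Ioc (-1) (R0 p)) := by
  refine antitoneOn_of_hasDerivWithinAt_nonpos (convex_Ioc _ _)
    (fun x hx => (hasDerivAt_lam hp hx.1).continuousAt.continuousWithinAt)
    (fun x hx => (hasDerivAt_lam hp (by rw [interior_Ioc] at hx; exact hx.1)).hasDerivWithinAt)
    fun x hx => ?_
  rw [interior_Ioc] at hx
  have h := mul_rpow_mul_one_add_le hp hx.1 hx.2
  have h1 : 0 < 1 + x := by linarith [hx.1]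
  have h2 := one_add_phi_pos hp hx.1
  have h3 : 0 ≤ (p - 1) * |x| ^ ((p - 2) / 2) :=
    mul_nonneg (by linarith) (Real.rpow_nonneg (abs_nonneg x) _)
  rw [neg_div, neg_add_nonpos_iff, ← div_pow, ← one_div_pow]
  refine pow_le_pow_left₀ (by positivity) ?_ 2
  rw [div_le_div_iff₀ h2 h1]
  linarith

theorem strictMonoOn_lam {p : ℝ} (hp : 2 < p) : StrictMonoOn (lam p) (Icc (R0 p) 1) := by
  have hr := isCriticalRadius_R0 hp
  have h0 := hr.1.1
  refine strictMonoOn_of_hasDerivWithinAt_pos (convex_Icc _ _)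
    (fun x hx => (hasDerivAt_lam hp (by linarith [hx.1])).continuousAt.continuousWithinAt)
    (fun x hx => (hasDerivAt_lam hp
      (by rw [interior_Icc] at hx; linarith [hx.1])).hasDerivWithinAt)
    fun x hx => ?_
  rw [interior_Icc] at hx
  have hx0 : 0 < x := h0.trans hx.1
  have h := hr.lt_of_gt hp hx.1 hx.2.le
  have h1 : 0 < 1 + x := by linarith
  have h2 := one_add_phi_pos hp (show -1 < x by linarith)
  rw [← phi_of_nonneg hp hx0.le] at h
  rw [neg_div, lt_neg_add_iff_lt, ← div_pow, ← one_div_pow, abs_of_pos hx0]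
  refine pow_lt_pow_left₀ ?_ (by positivity) two_ne_zero
  rw [div_lt_div_iff₀ h1 h2]
  linarith

theorem lam_le_lam_neg {p r : ℝ} (hp : 2 < p) (hr : 0 ≤ r) (hr1 : r < 1) :
    lam p r ≤ lam p (-r) := by
  -- Taking `s = r²` turns `s^((p-2)/2)` into `r^(p-2)` and `s^(p-1)` into `φ(r)²`, which is the
  -- numerator of `λ(-r) - λ(r)`.
  have h := mul_rpow_mul_one_sub_le hp (sq_nonneg r) (by nlinarith)
  rw [← Real.rpow_natCast, ← Real.rpow_mul hr, ← Real.rpow_mul hr,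
    show ((2 : ℕ) : ℝ) * ((p - 2) / 2) = p - 2 by push_cast; ring, mul_comm ((2 : ℕ) : ℝ) (p - 1),
    Real.rpow_mul hr, Real.rpow_natCast, Real.rpow_natCast, ← phi_of_nonneg hp hr] at h
  have hphi : r * r ^ (p - 2) = phi p r := by rw [phi, abs_of_nonneg hr]
  have hx := one_add_phi_pos hp (show -1 < r by linarith)
  have hy := one_add_phi_pos hp (show -1 < -r by linarith)
  rw [phi_neg] at hy
  rw [lam_of_ne (by linarith), lam_of_ne (by linarith), phi_neg, sub_le_iff_le_add, ← sub_nonneg]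
  have h1 : 0 < 1 + r := by linarith
  have h2 : 0 < 1 + -r := by linarith
  have h3 := mul_nonneg hr (sub_nonneg.2 h)
  have e : 1 / (1 + -r) - (p - 1) / (1 + -phi p r) + (p - 1) / (1 + phi p r) - 1 / (1 + r)
      = 2 * (r * (1 - phi p r ^ 2 - (p - 1) * r ^ (p - 2) * (1 - r ^ 2)))
        / ((1 + r) * (1 + -r) * (1 + phi p r) * (1 + -phi p r)) := by
    rw [mul_sub r, show r * ((p - 1) * r ^ (p - 2) * (1 - r ^ 2))
      = (p - 1) * phi p r * (1 - r ^ 2) by rw [← hphi]; ring]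
    field_simp
    ring
  rw [e]
  positivity

theorem lam_one (p : ℝ) : lam p 1 = -((p - 2) / 2) := by
  rw [lam_of_ne (by norm_num), phi_one]; ring

/-- Over a common denominator the difference has numerator `p - 2 - pt + pφ(t) - (p-2)t^p`, which
vanishes at `1` and decreases on `[0,1]`. -/
theorem lam_neg_le_lam_one {p t : ℝ} (hp : 2 < p) (ht : 0 ≤ t) (ht1 : t < 1) :
    lam p (-t) ≤ lam p 1 := by
  have hd : ∀ x : ℝ, HasDerivAt
      (fun x : ℝ => p - 2 - p * x + p * phi p x - (p - 2) * |x| ^ p)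
      (-p + p * ((p - 1) * |x| ^ (p - 2)) - (p - 2) * (p * phi p x)) x := fun x => by
    have h := ((((hasDerivAt_id x).const_mul p).const_sub (p - 2)).add
      ((hasDerivAt_phi hp x).const_mul p)).sub
      ((hasDerivAt_abs_rpow_phi hp x).const_mul (p - 2))
    refine h.congr_deriv ?_
    ring
  have hanti : AntitoneOn (fun x : ℝ => p - 2 - p * x + p * phi p x - (p - 2) * |x| ^ p)
      (Icc 0 1) := by
    refine antitoneOn_of_hasDerivWithinAt_nonpos (convex_Icc _ _)
      (fun x _ => (hd x).continuousAt.continuousWithinAt) (fun x _ => (hd x).hasDerivWithinAt)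
      fun x hx => ?_
    rw [interior_Icc] at hx
    have hp1 : 0 < p - 1 := by linarith
    -- Weighted AM-GM gives `(p-1)x^(p-2) ≤ (p-2)x^(p-1) + 1`, the sign of the derivative.
    have h := Real.geom_mean_le_arith_mean2_weighted (w₁ := (p - 2) / (p - 1))
      (w₂ := 1 / (p - 1)) (p₁ := x ^ (p - 1)) (p₂ := 1) (div_nonneg (by linarith) hp1.le)
      (by positivity) (Real.rpow_nonneg hx.1.le _) zero_le_one (by field_simp; ring)
    rw [← Real.rpow_mul hx.1.le, mul_div_cancel₀ _ hp1.ne', Real.one_rpow, mul_one, mul_one,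
      ← phi_of_nonneg hp hx.1.le] at h
    have h' := mul_le_mul_of_nonneg_left h (mul_nonneg (show 0 ≤ p by linarith) hp1.le)
    have e : p * (p - 1) * ((p - 2) / (p - 1) * phi p x + 1 / (p - 1))
        = p * ((p - 2) * phi p x + 1) := by field_simp
    rw [e] at h'
    rw [abs_of_pos hx.1]
    linarith
  have h := hanti ⟨ht, ht1.le⟩ (right_mem_Icc.2 zero_le_one) ht1.le
  simp only [phi_one, abs_one, Real.one_rpow, ← mul_phi hp t] at h
  have hy := one_add_phi_pos hp (show -1 < -t by linarith)
  rw [phi_neg] at hy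
  have h2 : 0 < 1 + -t := by linarith
  rw [lam_one, lam_of_ne (by linarith), phi_neg, ← sub_nonneg]
  have e : -((p - 2) / 2) - (1 / (1 + -t) - (p - 1) / (1 + -phi p t))
      = (p - 2 - p * t + p * phi p t - (p - 2) * (t * phi p t))
        / (2 * (1 + -t) * (1 + -phi p t)) := by
    field_simp
    ring
  rw [e]
  refine div_nonneg ?_ (by positivity)
  linarith

theorem rho_spec {p R : ℝ} (hp : 2 < p) (hR : R ∈ Icc (-1) (R0 p)) :
    rho p R ∈ Icc (R0 p) 1 ∧ lam p (rho p R) = lam p R := by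
  have hr := isCriticalRadius_R0 hp
  obtain ⟨h0, h1⟩ := hr.1
  rw [rho, if_pos hR.2]
  refine Classical.epsilon_spec (p := fun s => s ∈ Icc (R0 p) 1 ∧ lam p s = lam p R) ?_
  rcases hR.1.eq_or_lt with rfl | hR1
  -- The value assigned to `λ` at `-1` is exactly `λ(1)`.
  · exact ⟨1, right_mem_Icc.2 h1.le, by rw [lam_one]; simp [lam]⟩
  have hlow := antitoneOn_lam hp ⟨hR1, hR.2⟩ (right_mem_Ioc.2 (by linarith)) hR.2
  have hup : lam p R ≤ lam p 1 := by
    rcases le_total R 0 with h | h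
    · simpa using lam_neg_le_lam_one hp (neg_nonneg.2 h) (by linarith)
    · exact (lam_le_lam_neg hp h (by linarith [hR.2])).trans
        (lam_neg_le_lam_one hp h (by linarith [hR.2]))
  exact intermediate_value_Icc h1.le
    (fun x hx => (hasDerivAt_lam hp (by linarith [hx.1])).continuousAt.continuousWithinAt)
    ⟨hlow, hup⟩

theorem abs_le_rho {p R : ℝ} (hp : 2 < p) (hR : R ∈ Ioc (-1) (R0 p)) : |R| ≤ rho p R := by
  obtain ⟨hmem, hlam⟩ := rho_spec hp ⟨hR.1.le, hR.2⟩
  rcases le_total 0 R with h | h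
  · rw [abs_of_nonneg h]; exact hR.2.trans hmem.1
  rw [abs_of_nonpos h]
  by_contra! hlt
  -- If `ρ(R) < -R`, then `λ(ρ(R)) < λ(-R) ≤ λ(R)`, a contradiction.
  have h1 := strictMonoOn_lam hp hmem ⟨hmem.1.trans hlt.le, by linarith [hR.1]⟩ hlt
  have h2 := lam_le_lam_neg hp (neg_nonneg.2 h) (by linarith [hR.1])
  rw [neg_neg] at h2
  linarith

theorem hasMultipliers_rho {p q R : ℝ} (hp : 2 < p) (hpq : p.HolderConjugate q)
    (hR : R ∈ Icc (-1) (R0 p)) : HasMultipliers p q 1 1 (-rho p R) (-phi p R) := by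
  obtain ⟨hmem, hlam⟩ := rho_spec hp hR
  rcases hR.1.eq_or_lt with rfl | hR1
  · exact hasMultipliers_neg_one hpq
  rcases (hR.2.trans hmem.1).eq_or_lt with h | h
  · have h' : R = R0 p := le_antisymm hR.2 (hmem.1.trans h.ge)
    rw [← h, h']
    exact hasMultipliers_of_isCriticalRadius hp hpq (isCriticalRadius_R0 hp)
  · exact hasMultipliers_of_lam_eq hp hpq hR1 h hmem.2 (abs_le_rho hp ⟨hR1, hR.2⟩) hlam

/-- Substitute `u/a` and `v/b` in both forms and multiply the dominating one by `b`. Only this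
multiplication needs a sign, so `a` may be negative. -/
theorem HasMultipliers.scale {p q u₁ v₁ u₂ v₂ a b : ℝ} (h : HasMultipliers p q u₁ v₁ u₂ v₂)
    (ha : a ≠ 0) (hb : 0 < b) : HasMultipliers p q (u₁ * a) (v₁ * b) (u₂ * a) (v₂ * b) := by
  obtain ⟨d, c, h1, h2, h3, h4, h5, h6⟩ := h
  let σ : (Fin 5 → ℝ) → Fin 5 → ℝ := fun c =>
    ![c 0, c 1 / a, c 2 / |a| ^ p, c 3 / |b| ^ q, c 4 / (a * b)]
  have hσ : ∀ c u v, bellmanForm p q (σ c) u v = bellmanForm p q c (u / a) (v / b) := by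
    intro c u v
    simp only [bellmanForm, abs_div, Real.div_rpow (abs_nonneg _) (abs_nonneg _), σ]
    simp
    ring
  have hbσ : ∀ c u v, bellmanForm p q (b • c) u v = b * bellmanForm p q c u v := by
    intro c u v
    simp [bellmanForm]
    ring
  refine ⟨σ d, b • σ c, fun u v => ?_, fun u v h => ?_, ?_, ?_, ?_, ?_⟩
  · rw [hσ]; exact h1 _ _
  · rw [hσ] at h
    rw [hbσ, hσ, ← div_le_iff₀' hb]
    exact h2 _ _ h
  · rw [hσ, mul_div_cancel_right₀ _ ha, mul_div_cancel_right₀ _ hb.ne', h3]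
  · rw [hσ, mul_div_cancel_right₀ _ ha, mul_div_cancel_right₀ _ hb.ne', h4]
  · rw [hbσ, hσ, mul_div_cancel_right₀ _ ha, mul_div_cancel_right₀ _ hb.ne', h5, mul_comm]
  · rw [hbσ, hσ, mul_div_cancel_right₀ _ ha, mul_div_cancel_right₀ _ hb.ne', h6, mul_comm]

/-! ### From multipliers to extremal averages -/

/-- The affine function on the Bellman domain with the coefficients of `bellmanForm`. -/
noncomputable def bellmanAffine (c : Fin 5 → ℝ) : (Fin 4 → ℝ) →ᵃ[ℝ] ℝ :=
  (c 1 • LinearMap.proj 0 + c 2 • LinearMap.proj 1 + c 3 • LinearMap.proj 2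
    + c 4 • LinearMap.proj 3 : (Fin 4 → ℝ) →ₗ[ℝ] ℝ).toAffineMap + AffineMap.const ℝ _ (c 0)

theorem bellmanAffine_apply (c : Fin 5 → ℝ) (x : Fin 4 → ℝ) :
    bellmanAffine c x = c 0 + c 1 * x 0 + c 2 * x 1 + c 3 * x 2 + c 4 * x 3 := by
  simp [bellmanAffine]
  ring

/-- The Bellman point of a pair of constant functions. -/
noncomputable def bellmanPoint (p q u v : ℝ) : Fin 4 → ℝ := ![u, |u| ^ p, |v| ^ q, u * v]

theorem bellmanAffine_bellmanPoint (p q : ℝ) (c : Fin 5 → ℝ) (u v : ℝ) :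
    bellmanAffine c (bellmanPoint p q u v) = bellmanForm p q c u v := by
  simp [bellmanAffine_apply, bellmanForm, bellmanPoint]

/-- The averages of `g` over all admissible pairs. -/
def averages (α β p q : ℝ) (x : Fin 4 → ℝ) : Set ℝ :=
  {y | ∃ f g : ℝ → ℝ, IsAdmissible α β p q x f g ∧ y = ⨍ s in Icc α β, g s}

theorem average_Icc {α β : ℝ} (h : α < β) (w : ℝ → ℝ) :
    (⨍ s in Icc α β, w s) = (β - α)⁻¹ * ∫ s in Icc α β, w s := by
  rw [setAverage_eq, Real.volume_real_Icc_of_le h.le, smul_eq_mul]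

theorem average_ite {α β a b : ℝ} (hαβ : α < β) (ha : 0 ≤ a) (hb : 0 ≤ b) (hab : a + b = 1)
    (w₁ w₂ : ℝ) :
    (⨍ s in Icc α β, if s ≤ α + a * (β - α) then w₁ else w₂) = a * w₁ + b * w₂ := by
  have hpos : 0 < β - α := by linarith
  have e : (fun s : ℝ => if s ≤ α + a * (β - α) then w₁ else w₂)
      = fun s => w₂ + (Iic (α + a * (β - α))).indicator (fun _ => w₁ - w₂) s := by
    ext s
    by_cases hs : s ≤ α + a * (β - α) <;> simp [hs]
  have hset : Iic (α + a * (β - α)) ∩ Icc α β = Icc α (α + a * (β - α)) := by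
    ext s
    simp only [mem_inter_iff, mem_Iic, mem_Icc]
    constructor
    · rintro ⟨h1, h2, -⟩; exact ⟨h2, h1⟩
    · rintro ⟨h1, h2⟩; exact ⟨h2, h1, by nlinarith⟩
  rw [average_Icc hαβ, e, integral_add (integrable_const _)
    ((integrable_const _).indicator measurableSet_Iic), integral_indicator measurableSet_Iic,
    Measure.restrict_restrict measurableSet_Iic, hset]
  simp only [integral_const, measureReal_restrict_apply_univ, smul_eq_mul]
  rw [Real.volume_real_Icc_of_le hαβ.le, Real.volume_real_Icc_of_le (by nlinarith)]
  field_simp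
  linear_combination -(β - α) * w₂ * hab

theorem isAdmissible_ite {α β p q a b : ℝ} (hαβ : α < β) (ha : 0 ≤ a) (hb : 0 ≤ b)
    (hab : a + b = 1) (u₁ v₁ u₂ v₂ : ℝ) :
    IsAdmissible α β p q (a • bellmanPoint p q u₁ v₁ + b • bellmanPoint p q u₂ v₂)
      (fun s => if s ≤ α + a * (β - α) then u₁ else u₂)
      (fun s => if s ≤ α + a * (β - α) then v₁ else v₂) := by
  have hmem : ∀ (r : ENNReal) (w₁ w₂ : ℝ), MemLp
      (fun s => if s ≤ α + a * (β - α) then w₁ else w₂) r (volume.restrict (Icc α β)) := by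
    intro r w₁ w₂
    refine MemLp.of_bound
      (Measurable.ite measurableSet_Iic measurable_const measurable_const).aestronglyMeasurable
      (max ‖w₁‖ ‖w₂‖) (Filter.Eventually.of_forall fun s => ?_)
    split_ifs
    · exact le_max_left _ _
    · exact le_max_right _ _
  refine ⟨hmem _ _ _, hmem _ _ _, ?_, ?_, ?_, ?_⟩
  · simp [average_ite hαβ ha hb hab, bellmanPoint]
  · simp only [apply_ite (fun z : ℝ => |z| ^ p)]
    simp [average_ite hαβ ha hb hab, bellmanPoint]
  · simp only [apply_ite (fun z : ℝ => |z| ^ q)]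
    simp [average_ite hαβ ha hb hab, bellmanPoint]
  · have e : ∀ s : ℝ, (if s ≤ α + a * (β - α) then u₁ else u₂)
        * (if s ≤ α + a * (β - α) then v₁ else v₂)
        = if s ≤ α + a * (β - α) then u₁ * v₁ else u₂ * v₂ := by
      intro s; split_ifs <;> rfl
    simp only [e]
    simp [average_ite hαβ ha hb hab, bellmanPoint]

theorem IsAdmissible.integrable_and_average_bellmanForm {α β p q : ℝ} {x : Fin 4 → ℝ}
    {f g : ℝ → ℝ} (h : IsAdmissible α β p q x f g) (hpq : p.HolderConjugate q) (hαβ : α < β)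
    (c : Fin 5 → ℝ) :
    IntegrableOn (fun s => bellmanForm p q c (f s) (g s)) (Icc α β) ∧
      (⨍ s in Icc α β, bellmanForm p q c (f s) (g s)) = bellmanAffine c x := by
  have hpos : 0 < β - α := by linarith
  have hp : 1 ≤ ENNReal.ofReal p := by simpa using hpq.lt.le
  have i0 : IntegrableOn (fun _ : ℝ => c 0) (Icc α β) := integrableOn_const (by simp)
  have i1 : IntegrableOn f (Icc α β) := h.memLp_f.integrable hp
  have i2 : IntegrableOn (fun s => |f s| ^ p) (Icc α β) := by
    have := h.memLp_f.integrable_norm_rpow (by simpa using hpq.pos) (by simp)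
    simpa [IntegrableOn, ENNReal.toReal_ofReal hpq.nonneg] using this
  have i3 : IntegrableOn (fun s => |g s| ^ q) (Icc α β) := by
    have := h.memLp_g.integrable_norm_rpow (by simpa using hpq.symm.pos) (by simp)
    simpa [IntegrableOn, ENNReal.toReal_ofReal hpq.symm.nonneg] using this
  have i4 : IntegrableOn (fun s => f s * g s) (Icc α β) := by
    have := hpq.ennrealOfReal
    exact h.memLp_f.integrable_mul h.memLp_g
  have e1 := h.average_f
  have e2 := h.average_f_pow
  have e3 := h.average_g_pow
  have e4 := h.average_mul
  rw [average_Icc hαβ] at e1 e2 e3 e4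
  have j1 := i0.add (i1.const_mul (c 1))
  have j2 := j1.add (i2.const_mul (c 2))
  have j3 := j2.add (i3.const_mul (c 3))
  have j4 := j3.add (i4.const_mul (c 4))
  refine ⟨j4, ?_⟩
  have key : ∫ s in Icc α β, bellmanForm p q c (f s) (g s) = (β - α) * c 0
      + c 1 * (∫ s in Icc α β, f s) + c 2 * (∫ s in Icc α β, |f s| ^ p)
      + c 3 * (∫ s in Icc α β, |g s| ^ q) + c 4 * ∫ s in Icc α β, f s * g s := by
    have k4 := integral_add j3 (i4.const_mul (c 4))
    have k3 := integral_add j2 (i3.const_mul (c 3))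
    have k2 := integral_add j1 (i2.const_mul (c 2))
    have k1 := integral_add i0 (i1.const_mul (c 1))
    simp only [integral_const_mul, Pi.add_apply] at k1 k2 k3 k4
    simp only [bellmanForm]
    rw [k4, k3, k2, k1]
    simp [hαβ.le]
  rw [average_Icc hαβ, key, bellmanAffine_apply, ← e1, ← e2, ← e3, ← e4]
  field_simp

theorem HasMultipliers.exists_isGreatest {p q u₁ v₁ u₂ v₂ α β : ℝ}
    (h : HasMultipliers p q u₁ v₁ u₂ v₂) (hpq : p.HolderConjugate q) (hαβ : α < β) :
    ∃ L : (Fin 4 → ℝ) →ᵃ[ℝ] ℝ, ∀ x ∈ segment ℝ (bellmanPoint p q u₁ v₁) (bellmanPoint p q u₂ v₂),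
      IsGreatest (averages α β p q x) (L x) := by
  obtain ⟨d, c, h1, h2, h3, h4, h5, h6⟩ := h
  have hL : ∀ (c : Fin 5 → ℝ) (a b : ℝ), a + b = 1 →
      bellmanAffine c (a • bellmanPoint p q u₁ v₁ + b • bellmanPoint p q u₂ v₂)
        = a * bellmanForm p q c u₁ v₁ + b * bellmanForm p q c u₂ v₂ := by
    intro c a b hab
    rw [Convex.combo_affine_apply hab, bellmanAffine_bellmanPoint, bellmanAffine_bellmanPoint,
      smul_eq_mul, smul_eq_mul]
  refine ⟨bellmanAffine c, ?_⟩
  rintro x ⟨a, b, ha, hb, hab, rfl⟩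
  constructor
  · refine ⟨_, _, isAdmissible_ite hαβ ha hb hab u₁ v₁ u₂ v₂, ?_⟩
    rw [hL c a b hab, h5, h6, average_ite hαβ ha hb hab]
  · rintro y ⟨f, g, hfg, rfl⟩
    have hpos : 0 < β - α := by linarith
    obtain ⟨hd, hd'⟩ := hfg.integrable_and_average_bellmanForm hpq hαβ d
    obtain ⟨hc, hc'⟩ := hfg.integrable_and_average_bellmanForm hpq hαβ c
    -- On the segment the average of the constraint form is zero; being nonnegative, the form
    -- vanishes almost everywhere along `(f, g)`.
    rw [hL d a b hab, h3, h4, mul_zero, mul_zero, add_zero, average_Icc hαβ, mul_eq_zero,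
      or_iff_right (inv_pos.2 hpos).ne', integral_eq_zero_iff_of_nonneg (fun s => h1 _ _) hd] at hd'
    rw [← hc', average_Icc hαβ, average_Icc hαβ]
    refine mul_le_mul_of_nonneg_left (integral_mono_ae ?_ hc ?_) (inv_pos.2 hpos).le
    · exact hfg.memLp_g.integrable (by simpa using hpq.symm.lt.le)
    · filter_upwards [hd'] with s hs
      exact h2 _ _ hs

/-! ### The Bellman functions on the segment, and the symmetry `g ↦ -g` -/

theorem bellmanDPlus_eq {α β p q y : ℝ} {x : Fin 4 → ℝ} (h : IsGreatest (averages α β p q x) y) :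
    bellmanDPlus α β p q x = (y : EReal) := by
  refine IsGreatest.csSup_eq ⟨?_, ?_⟩
  · obtain ⟨f, g, hfg, rfl⟩ := h.1
    exact ⟨f, g, hfg, rfl⟩
  · rintro _ ⟨f, g, hfg, rfl⟩
    exact EReal.coe_le_coe_iff.2 (h.2 ⟨f, g, hfg, rfl⟩)

theorem bellmanDMinus_eq {α β p q y : ℝ} {x : Fin 4 → ℝ} (h : IsLeast (averages α β p q x) y) :
    bellmanDMinus α β p q x = (y : EReal) := by
  refine IsLeast.csInf_eq ⟨?_, ?_⟩
  · obtain ⟨f, g, hfg, rfl⟩ := h.1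
    exact ⟨f, g, hfg, rfl⟩
  · rintro _ ⟨f, g, hfg, rfl⟩
    exact EReal.coe_le_coe_iff.2 (h.2 ⟨f, g, hfg, rfl⟩)

/-- The action of `g ↦ -g` on the Bellman points. -/
def negMul : (Fin 4 → ℝ) →ₗ[ℝ] (Fin 4 → ℝ) where
  toFun x := ![x 0, x 1, x 2, -x 3]
  map_add' x y := by ext i; fin_cases i <;> simp [add_comm]
  map_smul' r x := by ext i; fin_cases i <;> simp

theorem IsAdmissible.neg_right {α β p q : ℝ} {x : Fin 4 → ℝ} {f g : ℝ → ℝ}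
    (h : IsAdmissible α β p q x f g) : IsAdmissible α β p q (negMul x) f (fun s => -g s) where
  memLp_f := h.memLp_f
  memLp_g := h.memLp_g.neg
  average_f := h.average_f
  average_f_pow := h.average_f_pow
  average_g_pow := by simp only [abs_neg]; exact h.average_g_pow
  average_mul := by
    simp only [mul_neg]
    rw [average_neg, h.average_mul]
    rfl

theorem isLeast_averages_neg {α β p q y : ℝ} {x : Fin 4 → ℝ}
    (h : IsGreatest (averages α β p q (negMul x)) y) : IsLeast (averages α β p q x) (-y) := by
  have hx : negMul (negMul x) = x := by
    ext i; fin_cases i <;> simp [negMul]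
  constructor
  · obtain ⟨f, g, hfg, rfl⟩ := h.1
    refine ⟨f, fun s => -g s, hx ▸ hfg.neg_right, ?_⟩
    rw [average_neg]
  · rintro _ ⟨f, g, hfg, rfl⟩
    have := h.2 ⟨f, fun s => -g s, hfg.neg_right, rfl⟩
    rw [average_neg] at this
    linarith

theorem endpointA_eq (p q a₁ a₂ : ℝ) : endpointA p q a₁ a₂ = bellmanPoint p q a₁ a₂ := rfl

theorem endpointB_eq {p q : ℝ} (hp : 2 < p) (hpq : p.HolderConjugate q) (a₁ a₂ R : ℝ) :
    endpointB p q a₁ a₂ R = bellmanPoint p q (-rho p R * a₁) (-phi p R * a₂) := by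
  have h : |(-phi p R) * a₂| ^ q = |R| ^ p * |a₂| ^ q := by
    rw [abs_mul, abs_neg, Real.mul_rpow (abs_nonneg _) (abs_nonneg _), abs_phi_rpow hp hpq]
  rw [endpointB, bellmanPoint, h, neg_mul, abs_neg]
  congr 4
  ring

theorem exists_isGreatest_segmentD {p q α β R a₁ a₂ : ℝ} (hp : 2 < p)
    (hpq : p.HolderConjugate q) (hαβ : α < β) (hR : R ∈ Icc (-1) (R0 p)) (ha₁ : a₁ ≠ 0)
    (ha₂ : 0 < a₂) : ∃ L : (Fin 4 → ℝ) →ᵃ[ℝ] ℝ, ∀ x ∈ segmentD p q a₁ a₂ R,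
      IsGreatest (averages α β p q x) (L x) := by
  have h := ((hasMultipliers_rho hp hpq hR).scale ha₁ ha₂).exists_isGreatest hpq hαβ
  rwa [one_mul, one_mul, ← endpointA_eq, ← endpointB_eq hp hpq] at h

theorem negMul_mem_segmentD {p q a₁ a₂ R : ℝ} {x : Fin 4 → ℝ} (hx : x ∈ segmentD p q a₁ a₂ R) :
    negMul x ∈ segmentD p q a₁ (-a₂) R := by
  have hA : negMul (endpointA p q a₁ a₂) = endpointA p q a₁ (-a₂) := by
    simp [negMul, endpointA]
  have hB : negMul (endpointB p q a₁ a₂ R) = endpointB p q a₁ (-a₂) R := by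
    simp [negMul, endpointB]
  rw [segmentD, ← hA, ← hB, ← LinearMap.coe_toAffineMap, ← image_segment]
  exact mem_image_of_mem _ hx

theorem mainTheorem5 (p q : ℝ) (hp : 2 < p) (hpq : p.HolderConjugate q)
    (α β : ℝ) (hαβ : α < β) (R : ℝ) (hR : R ∈ Set.Icc (-1) (R0 p))
    (a₁ a₂ : ℝ) (ha₁ : a₁ ≠ 0) :
    (0 < a₂ → IsLinearOn (bellmanDPlus α β p q) (segmentD p q a₁ a₂ R)) ∧
    (a₂ < 0 → IsLinearOn (bellmanDMinus α β p q) (segmentD p q a₁ a₂ R)) := by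
  refine ⟨fun ha₂ => ?_, fun ha₂ => ?_⟩
  · obtain ⟨L, hL⟩ := exists_isGreatest_segmentD (α := α) (β := β) hp hpq hαβ hR ha₁ ha₂
    exact ⟨L, fun x hx => bellmanDPlus_eq (hL x hx)⟩
  · obtain ⟨L, hL⟩ := exists_isGreatest_segmentD (α := α) (β := β) hp hpq hαβ hR ha₁
      (neg_pos.2 ha₂)
    exact ⟨-(L.comp negMul.toAffineMap), fun x hx =>
      bellmanDMinus_eq (isLeast_averages_neg (hL _ (negMul_mem_segmentD hx)))⟩
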